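/- Let $n,m,p\ge 0$ be integers and let $\mathcal G:(A,B,C,D)$ be the real discrete-time LTI system $$x_{k+1}=Ax_k+Bu_k,\qquad y_k=Cx_k+Du_k,\qquad k=0,1,2,\dots,$$ with state $x_k\in\mathbb R^n$, input $u_k\in\mathbb R^m$ and output $y_k\in\mathbb R^p$. Let $Q\in\mathbb R^{p\times p}$, $S\in\mathbb R^{p\times m}$, and let $R\in\mathbb R^{m\times m}$ be symmetric. The relations $\prec,\succ,\preceq$ refer to definiteness of real symmetric matrices, so that writing them includes symmetry. The system is called $(Q,S,R)$-dissipative if for every initial state $x_0\in\mathbb R^n$ there is a $\beta=\beta(x_0)\in\mathbb R$ such that $$\sum_{k=0}^{T}\bigl(y_k^{T}Qy_k+2\,y_k^{T}Su_k+u_k^{T}Ru_k\bigr)\ \ge\ \beta$$ for all input sequences $(u_k)_{k\ge 0}$ in $\mathbb R^m$ and all integers $T>0$, where $(y_k)$ is the output produced from $x_0$ by $(u_k)$. Suppose that $\mathcal G$ is controllable (every state can be steered to every other state in finite time) and observable (the input and output sequences determine the initial state). Then $Q\prec 0$ and $\mathcal G$ is $(Q,S,R)$-dissipative if and only if $Q$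 is invertible and there is a matrix $P\succ 0$ in $\mathbb R^{n\times n}$ such that $$\begin{bmatrix}-P&-C^{T}S&C^{T}&A^{T}\\-S^{T}C&-D^{T}S-S^{T}D-R&D^{T}&B^{T}\\C&D&Q^{-1}&0\\A&B&0&-P^{-1}\end{bmatrix}\preceq 0 .$$ -/

import Mathlib

/-- A real discrete-time linear time-invariant system
`x (k+1) = A x k + B u k`, `y k = C x k + D u k`
with state in `ℝⁿ`, input in `ℝᵐ` and output in `ℝᵖ`. -/
structure LTISystem (n m p : ℕ) where
  A : Matrix (Fin n) (Fin n) ℝ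
  B : Matrix (Fin n) (Fin m) ℝ
  C : Matrix (Fin p) (Fin n) ℝ
  D : Matrix (Fin p) (Fin m) ℝ

namespace LTISystem

open Matrix

variable {n m p : ℕ}

/-- The state at time `k`, started at `x₀` and driven by the input sequence `u`. -/
def state (G : LTISystem n m p) (x₀ : Fin n → ℝ) (u : ℕ → Fin m → ℝ) : ℕ → Fin n → ℝ
  | 0 => x₀
  | k + 1 => G.A *ᵥ state G x₀ u k + G.B *ᵥ u k

/-- The output at time `k`, started at `x₀` and driven by the input sequence `u`. -/
def output (G : LTISystem n m p) (x₀ : Fin n → ℝ) (u : ℕ → Fin m → ℝ) (k : ℕ) : Fin p → ℝ :=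
  G.C *ᵥ G.state x₀ u k + G.D *ᵥ u k

/-- Every state can be steered to every other state in finite time. -/
def IsControllable (G : LTISystem n m p) : Prop :=
  ∀ x₀ x₁ : Fin n → ℝ, ∃ (T : ℕ) (u : ℕ → Fin m → ℝ), G.state x₀ u T = x₁

/-- The initial state is determined by the input and output sequences. -/
def IsObservable (G : LTISystem n m p) : Prop :=
  ∀ (u : ℕ → Fin m → ℝ) (x₀ x₁ : Fin n → ℝ),
    (∀ k, G.output x₀ u k = G.output x₁ u k) → x₀ = x₁

/-- The quadratic supply `yᵀ Q y + 2 yᵀ S u + uᵀ R u` at one time instant. -/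
def supply (Q : Matrix (Fin p) (Fin p) ℝ) (S : Matrix (Fin p) (Fin m) ℝ)
    (R : Matrix (Fin m) (Fin m) ℝ) (u : Fin m → ℝ) (y : Fin p → ℝ) : ℝ :=
  y ⬝ᵥ (Q *ᵥ y) + 2 * (y ⬝ᵥ (S *ᵥ u)) + u ⬝ᵥ (R *ᵥ u)

/-- `(Q, S, R)`-dissipativity: for each initial state the supply accumulated over
`k = 0, …, T` has a lower bound, depending only on that initial state, that is valid for all
input sequences and all horizons `T > 0`. -/
def IsDissipative (G : LTISystem n m p) (Q : Matrix (Fin p) (Fin p) ℝ)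
    (S : Matrix (Fin p) (Fin m) ℝ) (R : Matrix (Fin m) (Fin m) ℝ) : Prop :=
  ∀ x₀ : Fin n → ℝ, ∃ β : ℝ, ∀ (u : ℕ → Fin m → ℝ) (T : ℕ), 0 < T →
    β ≤ ∑ k ∈ Finset.range (T + 1), supply Q S R (u k) (G.output x₀ u k)

/-- The symmetric `4 × 4` block matrix, with block sizes `n, m, p, n`,
```
[ -P        -Cᵀ S               Cᵀ    Aᵀ   ]
[ -Sᵀ C     -Dᵀ S - Sᵀ D - R    Dᵀ    Bᵀ   ]
[ C         D                   Q⁻¹   0    ]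
[ A         B                   0     -P⁻¹ ]
``` -/
noncomputable def lmiMatrix (G : LTISystem n m p) (Q : Matrix (Fin p) (Fin p) ℝ)
    (S : Matrix (Fin p) (Fin m) ℝ) (R : Matrix (Fin m) (Fin m) ℝ)
    (P : Matrix (Fin n) (Fin n) ℝ) :
    Matrix ((Fin n ⊕ Fin m) ⊕ (Fin p ⊕ Fin n)) ((Fin n ⊕ Fin m) ⊕ (Fin p ⊕ Fin n)) ℝ :=
  fromBlocks
    (fromBlocks (-P) (-(G.Cᵀ * S)) (-(Sᵀ * G.C)) (-(G.Dᵀ * S) - Sᵀ * G.D - R))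
    (fromBlocks G.Cᵀ G.Aᵀ G.Dᵀ G.Bᵀ)
    (fromBlocks G.C G.D G.A G.B)
    (fromBlocks Q⁻¹ 0 0 (-P⁻¹))

end LTISystem

/-! The storage function is the available storage V(x), the supremum of the supply that can be
extracted from x; dissipativity makes it finite. By dynamic programming V satisfies the dissipation
inequality, and observability with Q ≺ 0 makes it positive off 0.

The main point is that V is quadratic. Since Q ≺ 0, applying zero input extracts a nonnegative
amount, so a near-optimal input, padded with zeros, stays near-optimal at all later horizons. An
identity between nonnegative combinations of quadratic forms in (x, u) can therefore be passed to
the suprema over u at one common horizon (`sum_sup_le_sum_sup`). The identities behind polarization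
then make V a quadratic form (`exists_bilin_of_sup`), whose matrix is P.

A Schur complement identifies the matrix inequality with the dissipation inequality for xᵀPx, which
conversely telescopes to dissipativity. -/

namespace LTISystem

open Matrix

variable {n m p : ℕ}

/-! ### Partial suprema of quadratic forms -/

section Supremum

variable {X U : Type*}

/-- A positive combination inequality that holds between the quadratic forms after a change of
the auxiliary variables passes to their suprema over the auxiliary variables. -/
theorem sum_sup_le_sum_sup {ι κ : Type*} [Fintype ι] [Fintype κ]
    {q : ℕ → X × U → ℝ} {V : X → ℝ} (hle : ∀ N z, q N z ≤ V z.1)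
    (happ : ∀ x, ∀ ε > 0, ∃ u N, ∀ M ≥ N, V x - ε < q M (x, u))
    (a : ι → X) (b : κ → X) (c : ι → ℝ) (d : κ → ℝ) (hc : ∀ i, 0 ≤ c i) (hd : ∀ j, 0 ≤ d j)
    (h : ∀ u : ι → U, ∃ v : κ → U, ∀ N,
      ∑ i, c i * q N (a i, u i) = ∑ j, d j * q N (b j, v j)) :
    ∑ i, c i * V (a i) ≤ ∑ j, d j * V (b j) := by
  have key : ∀ ε > 0, ∑ i, c i * V (a i) ≤ ∑ j, d j * V (b j) + (∑ i, c i) * ε := by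
    intro ε hε
    choose u N hN using fun i => happ (a i) ε hε
    obtain ⟨v, hv⟩ := h u
    -- The sum of the `N i` serves as a horizon late enough for every `i` at once.
    have h1 : ∑ i, c i * (V (a i) - ε) ≤ ∑ i, c i * q (∑ i, N i) (a i, u i) :=
      Finset.sum_le_sum fun i _ => mul_le_mul_of_nonneg_left
        (hN i _ (Finset.single_le_sum (fun _ _ => Nat.zero_le _) (Finset.mem_univ i))).le (hc i)
    have h2 : ∑ j, d j * q (∑ i, N i) (b j, v j) ≤ ∑ j, d j * V (b j) :=
      Finset.sum_le_sum fun j _ => mul_le_mul_of_nonneg_left (hle _ _) (hd j)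
    have h3 : ∑ i, c i * (V (a i) - ε) = ∑ i, c i * V (a i) - (∑ i, c i) * ε := by
      simp only [mul_sub, Finset.sum_sub_distrib, Finset.sum_mul]
    linarith [hv (∑ i, N i)]
  have hs : 0 ≤ ∑ i, c i := Finset.sum_nonneg fun i _ => hc i
  refine le_of_forall_pos_le_add fun ε hε => (key (ε / (∑ i, c i + 1)) (by positivity)).trans ?_
  gcongr
  rw [mul_div_assoc', div_le_iff₀ (by positivity)]
  nlinarith

variable [AddCommGroup X] [Module ℝ X] [AddCommGroup U] [Module ℝ U]

/-- The supremum of a directed family of quadratic forms over part of the variables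
is a quadratic form. -/
theorem exists_bilin_of_sup {q : ℕ → X × U → ℝ} {V : X → ℝ}
    (β : ℕ → (X × U) →ₗ[ℝ] (X × U) →ₗ[ℝ] ℝ) (hq : ∀ N z, q N z = β N z z)
    (hle : ∀ N z, q N z ≤ V z.1)
    (happ : ∀ x, ∀ ε > 0, ∃ u N, ∀ M ≥ N, V x - ε < q M (x, u)) :
    ∃ b : X →ₗ[ℝ] X →ₗ[ℝ] ℝ, (∀ x y, b x y = b y x) ∧ ∀ x, b x x = V x := by
  have hhom : ∀ (c : ℝ), c ≠ 0 → ∀ x, V (c • x) = c ^ 2 * V x := by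
    have : ∀ (c : ℝ), c ≠ 0 → ∀ x, c ^ 2 * V x ≤ V (c • x) := by
      intro c hc x
      have := sum_sup_le_sum_sup hle happ ![x] ![c • x] ![c ^ 2] ![1] (by simp [sq_nonneg])
        (by simp) (fun u => by
          refine ⟨![c • u 0], fun N => ?_⟩
          have : ((c • x, c • u 0) : X × U) = c • (x, u 0) := rfl
          simp only [Fin.sum_univ_one, hq, cons_val_fin_one, this, map_smul,
            LinearMap.smul_apply, smul_eq_mul]
          ring)
      simpa using this
    intro c hc x
    refine le_antisymm ?_ (this c hc x)
    have h := this c⁻¹ (inv_ne_zero hc) (c • x)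
    rwa [inv_smul_smul₀ hc, inv_pow, inv_mul_le_iff₀ (by positivity)] at h
  have hneg : ∀ x, V (-x) = V x := fun x => by simpa using hhom (-1) (by norm_num) x
  -- The terms are moved so that both sides have nonnegative coefficients, hence `0 < t`. Replacing
  -- `y` by `-y` gives the reverse inequality; the same device proves `hadd`.
  have hsmul : ∀ (t : ℝ), 0 < t → ∀ x y,
      V (t • x + y) - V (t • x - y) = t * (V (x + y) - V (x - y)) := by
    have : ∀ (t : ℝ), 0 < t → ∀ x y,
      V (t • x + y) + t * V (x - y) ≤ V (t • x - y) + t * V (x + y) := by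
      intro t ht x y
      have := sum_sup_le_sum_sup hle happ ![t • x + y, x - y] ![t • x - y, x + y] ![1, t] ![1, t]
        (by simp [Fin.forall_fin_two, ht.le]) (by simp [Fin.forall_fin_two, ht.le]) (fun u => by
          -- Solution of `u 0 = t • v + w`, `u 1 = v - w`, so that inputs combine exactly as the
          -- states do.
          set v := (1 + t)⁻¹ • (u 0 + u 1) with hv
          set w := (1 + t)⁻¹ • (u 0 - t • u 1) with hw
          have ht' : (1 + t) ≠ 0 := by positivity
          have h0 : u 0 = t • v + w := by
            rw [hv, hw]; match_scalars <;> field_simp <;> ring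
          have h1 : u 1 = v - w := by
            rw [hv, hw]; match_scalars <;> field_simp <;> ring
          refine ⟨![t • v - w, v + w], fun N => ?_⟩
          have e1 : ((t • x + y, t • v + w) : X × U) = t • (x, v) + (y, w) := rfl
          have e2 : ((x - y, v - w) : X × U) = (x, v) - (y, w) := rfl
          have e3 : ((t • x - y, t • v - w) : X × U) = t • (x, v) - (y, w) := rfl
          have e4 : ((x + y, v + w) : X × U) = (x, v) + (y, w) := rfl
          simp only [Fin.sum_univ_two, hq, h0, h1, cons_val_zero, cons_val_one, e1, e2, e3, e4,
            map_add, map_sub, map_smul, LinearMap.add_apply, LinearMap.sub_apply,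
            LinearMap.smul_apply, smul_eq_mul]
          ring)
      simpa using this
    intro t ht x y
    have h1 := this t ht x y
    have h2 := this t ht x (-y)
    simp only [sub_neg_eq_add, ← sub_eq_add_neg] at h2
    linarith
  have hadd : ∀ x x' y, V (x + x' + y) - V (x + x' - y) =
      (V (x + y) - V (x - y)) + (V (x' + y) - V (x' - y)) := by
    have : ∀ x x' y, V (x + x' + y) + V (x - y) + V (x' - y) ≤
        V (x + x' - y) + V (x + y) + V (x' + y) := by
      intro x x' y
      have := sum_sup_le_sum_sup hle happ ![x + x' + y, x - y, x' - y]
        ![x + x' - y, x + y, x' + y] ![1, 1, 1] ![1, 1, 1]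
        (by simp [Fin.forall_fin_succ]) (by simp [Fin.forall_fin_succ]) (fun u => by
          -- Solution of `u 0 = v + v' + w`, `u 1 = v - w`, `u 2 = v' - w`.
          set w := (3 : ℝ)⁻¹ • (u 0 - u 1 - u 2) with hw
          set v := u 1 + w with hv
          set v' := u 2 + w with hv'
          have h0 : u 0 = v + v' + w := by
            rw [hv, hv', hw]; match_scalars <;> norm_num
          have h1 : u 1 = v - w := by rw [hv]; abel
          have h2 : u 2 = v' - w := by rw [hv']; abel
          refine ⟨![v + v' - w, v + w, v' + w], fun N => ?_⟩
          have e1 : ((x + x' + y, v + v' + w) : X × U) = (x, v) + (x', v') + (y, w) := rfl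
          have e2 : ((x - y, v - w) : X × U) = (x, v) - (y, w) := rfl
          have e3 : ((x' - y, v' - w) : X × U) = (x', v') - (y, w) := rfl
          have e4 : ((x + x' - y, v + v' - w) : X × U) = (x, v) + (x', v') - (y, w) := rfl
          have e5 : ((x + y, v + w) : X × U) = (x, v) + (y, w) := rfl
          have e6 : ((x' + y, v' + w) : X × U) = (x', v') + (y, w) := rfl
          simp only [Fin.sum_univ_three, hq, h0, h1, h2, cons_val_zero, cons_val_one, cons_val,
            e1, e2, e3, e4, e5, e6,
            map_add, map_sub, LinearMap.add_apply, LinearMap.sub_apply]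
          ring)
      simpa [Fin.sum_univ_three] using this
    intro x x' y
    have h1 := this x x' y
    have h2 := this x x' (-y)
    simp only [sub_neg_eq_add, ← sub_eq_add_neg] at h2
    linarith
  have hzero : V 0 = 0 := by
    have h := hhom 2 two_ne_zero 0
    rw [smul_zero] at h
    linarith
  have hcomm : ∀ x y, V (x + y) - V (x - y) = V (y + x) - V (y - x) := fun x y => by
    rw [add_comm, ← hneg (x - y), neg_sub]
  have hsmul' : ∀ (t : ℝ) x y,
      V (t • x + y) - V (t • x - y) = t * (V (x + y) - V (x - y)) := by
    intro t x y
    rcases lt_trichotomy t 0 with ht | rfl | ht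
    · have h := hsmul (-t) (by linarith) x y
      have e1 : V (t • x + y) = V (-t • x - y) := by rw [← hneg]; congr 1; module
      have e2 : V (t • x - y) = V (-t • x + y) := by rw [← hneg]; congr 1; module
      rw [e1, e2]; linarith
    · simp [hneg]
    · exact hsmul t ht x y
  refine ⟨LinearMap.mk₂ ℝ (fun x y => (V (x + y) - V (x - y)) / 4) ?_ ?_ ?_ ?_, ?_, ?_⟩
  · intro x x' y; rw [hadd]; ring
  · intro t x y; rw [hsmul', smul_eq_mul]; ring
  · intro x y y'; rw [hcomm, hadd, hcomm x y, hcomm x y']; ring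
  · intro t x y; rw [hcomm, hsmul', hcomm x y, smul_eq_mul]; ring
  · intro x y; simp only [LinearMap.mk₂_apply]; rw [hcomm]
  · intro x
    have h := hhom 2 two_ne_zero x
    simp only [LinearMap.mk₂_apply, sub_self, hzero, ← two_smul ℝ x, h]
    ring

end Supremum

/-! ### The accumulated supply -/

/-- The state at time `k` as a linear map of initial state and input sequence. -/
def stateLin (G : LTISystem n m p) : ℕ → ((Fin n → ℝ) × (ℕ → Fin m → ℝ)) →ₗ[ℝ] (Fin n → ℝ)
  | 0 => LinearMap.fst ℝ _ _
  | k + 1 => G.A.mulVecLin ∘ₗ stateLin G k +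
      G.B.mulVecLin ∘ₗ LinearMap.proj k ∘ₗ LinearMap.snd ℝ _ _

theorem stateLin_apply (G : LTISystem n m p) (x : Fin n → ℝ) (u : ℕ → Fin m → ℝ) (k : ℕ) :
    G.stateLin k (x, u) = G.state x u k := by
  induction k with
  | zero => rfl
  | succ k ih => simp [stateLin, state, ih]

/-- The output at time `k` as a linear map of initial state and input sequence. -/
def outputLin (G : LTISystem n m p) (k : ℕ) :
    ((Fin n → ℝ) × (ℕ → Fin m → ℝ)) →ₗ[ℝ] (Fin p → ℝ) :=
  G.C.mulVecLin ∘ₗ G.stateLin k + G.D.mulVecLin ∘ₗ LinearMap.proj k ∘ₗ LinearMap.snd ℝ _ _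

theorem outputLin_apply (G : LTISystem n m p) (x : Fin n → ℝ) (u : ℕ → Fin m → ℝ) (k : ℕ) :
    G.outputLin k (x, u) = G.output x u k := by
  simp [outputLin, output, stateLin_apply]

/-- The supply extracted during the first `N` time instants. -/
def extracted (G : LTISystem n m p) (Q : Matrix (Fin p) (Fin p) ℝ)
    (S : Matrix (Fin p) (Fin m) ℝ) (R : Matrix (Fin m) (Fin m) ℝ) (N : ℕ)
    (z : (Fin n → ℝ) × (ℕ → Fin m → ℝ)) : ℝ :=
  -∑ k ∈ Finset.range N, supply Q S R (z.2 k) (G.output z.1 z.2 k)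

/-- A bilinear map whose diagonal is the extracted supply. -/
noncomputable def extractedBilin (G : LTISystem n m p) (Q : Matrix (Fin p) (Fin p) ℝ)
    (S : Matrix (Fin p) (Fin m) ℝ) (R : Matrix (Fin m) (Fin m) ℝ) (N : ℕ) :
    ((Fin n → ℝ) × (ℕ → Fin m → ℝ)) →ₗ[ℝ] ((Fin n → ℝ) × (ℕ → Fin m → ℝ)) →ₗ[ℝ] ℝ :=
  -∑ k ∈ Finset.range N,
    ((Matrix.toLinearMap₂' ℝ Q).compl₁₂ (G.outputLin k) (G.outputLin k) +
      (2 : ℝ) • (Matrix.toLinearMap₂' ℝ S).compl₁₂ (G.outputLin k)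
        (LinearMap.proj k ∘ₗ LinearMap.snd ℝ _ _) +
      (Matrix.toLinearMap₂' ℝ R).compl₁₂ (LinearMap.proj k ∘ₗ LinearMap.snd ℝ _ _)
        (LinearMap.proj k ∘ₗ LinearMap.snd ℝ _ _))

theorem extracted_eq_bilin (G : LTISystem n m p) (Q : Matrix (Fin p) (Fin p) ℝ)
    (S : Matrix (Fin p) (Fin m) ℝ) (R : Matrix (Fin m) (Fin m) ℝ) (N : ℕ)
    (z : (Fin n → ℝ) × (ℕ → Fin m → ℝ)) :
    G.extracted Q S R N z = G.extractedBilin Q S R N z z := by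
  obtain ⟨x, u⟩ := z
  simp [extracted, extractedBilin, supply, outputLin_apply, toLinearMap₂'_apply',
    LinearMap.sum_apply]

theorem state_congr (G : LTISystem n m p) (x : Fin n → ℝ) {u v : ℕ → Fin m → ℝ} {k : ℕ}
    (h : ∀ j < k, u j = v j) : G.state x u k = G.state x v k := by
  induction k with
  | zero => rfl
  | succ k ih => simp only [state]; rw [ih fun j hj => h j (by omega), h k (by omega)]

theorem output_congr (G : LTISystem n m p) (x : Fin n → ℝ) {u v : ℕ → Fin m → ℝ} {k : ℕ}
    (h : ∀ j ≤ k, u j = v j) : G.output x u k = G.output x v k := by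
  simp only [output]; rw [G.state_congr x fun j hj => h j hj.le, h k le_rfl]

theorem state_succ_eq (G : LTISystem n m p) (x : Fin n → ℝ) (u : ℕ → Fin m → ℝ) (k : ℕ) :
    G.state x u (k + 1) = G.state (G.A *ᵥ x + G.B *ᵥ u 0) (fun j => u (j + 1)) k := by
  induction k with
  | zero => rfl
  | succ k ih => rw [state, ih]; rfl

theorem output_succ_eq (G : LTISystem n m p) (x : Fin n → ℝ) (u : ℕ → Fin m → ℝ) (k : ℕ) :
    G.output x u (k + 1) = G.output (G.A *ᵥ x + G.B *ᵥ u 0) (fun j => u (j + 1)) k := by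
  simp only [output, state_succ_eq]

theorem extracted_succ (G : LTISystem n m p) (Q : Matrix (Fin p) (Fin p) ℝ)
    (S : Matrix (Fin p) (Fin m) ℝ) (R : Matrix (Fin m) (Fin m) ℝ) (N : ℕ) (x : Fin n → ℝ)
    (u : ℕ → Fin m → ℝ) :
    G.extracted Q S R (N + 1) (x, u) =
      G.extracted Q S R N (G.A *ᵥ x + G.B *ᵥ u 0, fun j => u (j + 1)) -
        supply Q S R (u 0) (G.C *ᵥ x + G.D *ᵥ u 0) := by
  simp only [extracted, Finset.sum_range_succ', output_succ_eq]
  simp only [output, state]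
  ring

theorem supply_zero_nonpos {Q : Matrix (Fin p) (Fin p) ℝ} (hQ : (-Q).PosDef)
    (S : Matrix (Fin p) (Fin m) ℝ) (R : Matrix (Fin m) (Fin m) ℝ) (y : Fin p → ℝ) :
    supply Q S R 0 y ≤ 0 := by
  have := hQ.posSemidef.dotProduct_mulVec_nonneg y
  simp [neg_mulVec] at this
  simpa [supply] using this

/-- With zero input the supply is yᵀQy ≤ 0, so waiting never loses extracted supply. -/
theorem extracted_le_of_trailing_zero (G : LTISystem n m p) {Q : Matrix (Fin p) (Fin p) ℝ}
    (hQ : (-Q).PosDef) (S : Matrix (Fin p) (Fin m) ℝ) (R : Matrix (Fin m) (Fin m) ℝ)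
    (x : Fin n → ℝ) (u : ℕ → Fin m → ℝ) {N M : ℕ} (hNM : N ≤ M) :
    G.extracted Q S R N (x, u) ≤
      G.extracted Q S R M (x, fun k => if k < N then u k else 0) := by
  set v : ℕ → Fin m → ℝ := fun k => if k < N then u k else 0 with hv
  simp only [extracted, neg_le_neg_iff]
  rw [← Finset.sum_range_add_sum_Ico _ hNM]
  have h1 : ∑ k ∈ Finset.range N, supply Q S R (v k) (G.output x v k) =
      ∑ k ∈ Finset.range N, supply Q S R (u k) (G.output x u k) := by
    refine Finset.sum_congr rfl fun k hk => ?_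
    have hk := Finset.mem_range.1 hk
    have : ∀ j ≤ k, v j = u j := fun j hj => if_pos (by omega)
    rw [G.output_congr x this, this k le_rfl]
  have h2 : ∑ k ∈ Finset.Ico N M, supply Q S R (v k) (G.output x v k) ≤ 0 := by
    refine Finset.sum_nonpos fun k hk => ?_
    have hk := (Finset.mem_Ico.1 hk).1
    have : v k = 0 := if_neg (by omega)
    rw [this]
    exact supply_zero_nonpos hQ S R _
  linarith

/-- The available storage: the supremum of the supply that can be extracted. -/
noncomputable def availableStorage (G : LTISystem n m p) (Q : Matrix (Fin p) (Fin p) ℝ)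
    (S : Matrix (Fin p) (Fin m) ℝ) (R : Matrix (Fin m) (Fin m) ℝ) (x : Fin n → ℝ) : ℝ :=
  ⨆ w : ℕ × (ℕ → Fin m → ℝ), G.extracted Q S R w.1 (x, w.2)

/-! ### Storage functions and dissipativity -/

section Dissipative

variable {G : LTISystem n m p} {Q : Matrix (Fin p) (Fin p) ℝ} {S : Matrix (Fin p) (Fin m) ℝ}
  {R : Matrix (Fin m) (Fin m) ℝ}

theorem IsDissipative.bddAbove_extracted (h : G.IsDissipative Q S R) (hQ : (-Q).PosDef)
    (x : Fin n → ℝ) :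
    BddAbove (Set.range fun w : ℕ × (ℕ → Fin m → ℝ) => G.extracted Q S R w.1 (x, w.2)) := by
  obtain ⟨β, hβ⟩ := h x
  refine ⟨-β, ?_⟩
  rintro _ ⟨⟨N, u⟩, rfl⟩
  -- Padding to `N + 2` terms gives the horizon `T = N + 1`, positive even when `N = 0`.
  refine (G.extracted_le_of_trailing_zero hQ S R x u (by omega : N ≤ N + 1 + 1)).trans ?_
  exact neg_le_neg (hβ _ (N + 1) (Nat.succ_pos N))

theorem IsDissipative.extracted_le (h : G.IsDissipative Q S R) (hQ : (-Q).PosDef) (N : ℕ)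
    (z : (Fin n → ℝ) × (ℕ → Fin m → ℝ)) :
    G.extracted Q S R N z ≤ G.availableStorage Q S R z.1 :=
  le_ciSup (h.bddAbove_extracted hQ z.1) (N, z.2)

theorem IsDissipative.exists_lt_extracted (hQ : (-Q).PosDef)
    (x : Fin n → ℝ) (ε : ℝ) (hε : 0 < ε) :
    ∃ u N, ∀ M ≥ N, G.availableStorage Q S R x - ε < G.extracted Q S R M (x, u) := by
  obtain ⟨⟨N, u⟩, hN⟩ := exists_lt_of_lt_ciSup (sub_lt_self (G.availableStorage Q S R x) hε)
  exact ⟨_, N, fun M hM => hN.trans_le (G.extracted_le_of_trailing_zero hQ S R x u hM)⟩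

/-- Prepending `u` to any input used from the successor state gives a competitor for the supremum at
`x`. -/
theorem IsDissipative.availableStorage_le (h : G.IsDissipative Q S R) (hQ : (-Q).PosDef)
    (x : Fin n → ℝ) (u : Fin m → ℝ) :
    G.availableStorage Q S R (G.A *ᵥ x + G.B *ᵥ u) ≤
      G.availableStorage Q S R x + supply Q S R u (G.C *ᵥ x + G.D *ᵥ u) := by
  refine ciSup_le fun ⟨N, v⟩ => ?_
  obtain ⟨w, rfl, rfl⟩ : ∃ w : ℕ → Fin m → ℝ, w 0 = u ∧ (fun j => w (j + 1)) = v :=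
    ⟨fun k => Nat.casesOn k u v, rfl, rfl⟩
  have h1 := h.extracted_le hQ (N + 1) (x, w)
  rw [extracted_succ] at h1
  exact sub_le_iff_le_add.1 h1

/-- If no supply could be extracted, the zero-input output from `x` would vanish identically, as it
does from 0, contradicting observability. -/
theorem IsDissipative.availableStorage_pos (h : G.IsDissipative Q S R) (hQ : (-Q).PosDef)
    (hobs : G.IsObservable) {x : Fin n → ℝ} (hx : x ≠ 0) :
    0 < G.availableStorage Q S R x := by
  by_contra hV
  refine hx (hobs 0 x 0 fun k => ?_)
  have h0 : ∀ k, G.state 0 0 k = 0 := fun k => by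
    induction k with
    | zero => rfl
    | succ k ih => simp [state, ih]
  have hz : G.output 0 0 k = 0 := by simp [output, h0]
  rw [hz]
  by_contra hy
  have h1 := h.extracted_le hQ (k + 1) (x, 0)
  have h2 := hQ.dotProduct_mulVec_pos hy
  have h3 : ∑ j ∈ Finset.range k, supply Q S R 0 (G.output x 0 j) ≤ 0 :=
    Finset.sum_nonpos fun j _ => supply_zero_nonpos hQ S R _
  simp only [extracted, Finset.sum_range_succ, Pi.zero_apply] at h1
  have h4 : supply Q S R 0 (G.output x 0 k) =
      G.output x 0 k ⬝ᵥ (Q *ᵥ G.output x 0 k) := by simp [supply]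
  simp [neg_mulVec] at h2
  linarith

theorem IsDissipative.exists_posDef (h : G.IsDissipative Q S R) (hQ : (-Q).PosDef)
    (hobs : G.IsObservable) :
    ∃ P : Matrix (Fin n) (Fin n) ℝ, P.PosDef ∧ ∀ x u,
      (G.A *ᵥ x + G.B *ᵥ u) ⬝ᵥ (P *ᵥ (G.A *ᵥ x + G.B *ᵥ u)) ≤
        x ⬝ᵥ (P *ᵥ x) + supply Q S R u (G.C *ᵥ x + G.D *ᵥ u) := by
  obtain ⟨b, hsymm, hb⟩ := exists_bilin_of_sup (G.extractedBilin Q S R)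
    (G.extracted_eq_bilin Q S R) (h.extracted_le hQ) (IsDissipative.exists_lt_extracted hQ)
  have hP : ∀ x, x ⬝ᵥ (LinearMap.toMatrix₂' ℝ b *ᵥ x) = G.availableStorage Q S R x := by
    intro x
    rw [← hb, ← toLinearMap₂'_apply', toLinearMap₂'_toMatrix']
  refine ⟨LinearMap.toMatrix₂' ℝ b, .of_dotProduct_mulVec_pos ?_ fun x hx => ?_, fun x u => ?_⟩
  · ext i j
    simp [LinearMap.toMatrix₂'_apply, hsymm]
  · rw [star_trivial, hP]
    exact h.availableStorage_pos hQ hobs hx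
  · rw [hP, hP]
    exact h.availableStorage_le hQ x u

theorem isDissipative_of_storage {P : Matrix (Fin n) (Fin n) ℝ} (hP : P.PosSemidef)
    (h : ∀ x u, (G.A *ᵥ x + G.B *ᵥ u) ⬝ᵥ (P *ᵥ (G.A *ᵥ x + G.B *ᵥ u)) ≤
        x ⬝ᵥ (P *ᵥ x) + supply Q S R u (G.C *ᵥ x + G.D *ᵥ u)) :
    G.IsDissipative Q S R := by
  intro x
  refine ⟨-(x ⬝ᵥ (P *ᵥ x)), fun u T _ => ?_⟩
  have key : ∀ N, G.state x u N ⬝ᵥ (P *ᵥ G.state x u N) ≤ x ⬝ᵥ (P *ᵥ x) +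
      ∑ k ∈ Finset.range N, supply Q S R (u k) (G.output x u k) := by
    intro N
    induction N with
    | zero => simp [state]
    | succ N ih =>
      have := h (G.state x u N) (u N)
      rw [Finset.sum_range_succ, state, output]
      linarith
  have h1 := key (T + 1)
  have h2 := hP.dotProduct_mulVec_nonneg (G.state x u (T + 1))
  rw [star_trivial] at h2
  linarith

/-! ### The linear matrix inequality -/

theorem posDef_fromBlocks_diagonal {ι κ : Type*} [Fintype ι] [Fintype κ]
    {M : Matrix ι ι ℝ} {N : Matrix κ κ ℝ} (hM : M.PosDef) (hN : N.PosDef) :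
    (fromBlocks M 0 0 N).PosDef := by
  refine .of_dotProduct_mulVec_pos ?_ fun z hz => ?_
  · exact hM.isHermitian.fromBlocks (by simp) hN.isHermitian
  · obtain ⟨x, y, rfl⟩ : ∃ x y, z = Sum.elim x y := ⟨_, _, (Sum.elim_comp_inl_inr z).symm⟩
    have hx := hM.posSemidef.dotProduct_mulVec_nonneg x
    have hy := hN.posSemidef.dotProduct_mulVec_nonneg y
    rw [star_trivial] at hx hy ⊢
    simp only [fromBlocks_mulVec, Sum.elim_comp_inl, Sum.elim_comp_inr, zero_mulVec, add_zero,
      zero_add, sumElim_dotProduct_sumElim]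
    by_cases h0 : x = 0
    · have hy0 : y ≠ 0 := by
        rintro rfl; subst h0; apply hz; ext i; cases i <;> rfl
      have := hN.dotProduct_mulVec_pos hy0
      rw [star_trivial] at this
      linarith
    · have := hM.dotProduct_mulVec_pos h0
      rw [star_trivial] at this
      linarith

/-- The lower right block of the negated matrix is diag(-Q⁻¹, P⁻¹), with inverse diag(-Q, P). The
quadratic form of its Schur complement is the slack in the dissipation inequality. -/
theorem posSemidef_neg_lmiMatrix_iff (hR : R.IsSymm) (hQ : (-Q).PosDef)
    {P : Matrix (Fin n) (Fin n) ℝ} (hP : P.PosDef) :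
    (-(G.lmiMatrix Q S R P)).PosSemidef ↔
      ∀ x u, (G.A *ᵥ x + G.B *ᵥ u) ⬝ᵥ (P *ᵥ (G.A *ᵥ x + G.B *ᵥ u)) ≤
        x ⬝ᵥ (P *ᵥ x) + supply Q S R u (G.C *ᵥ x + G.D *ᵥ u) := by
  have hQi : (-Q)⁻¹ = -Q⁻¹ := by
    refine inv_eq_right_inv ?_
    have := (isUnit_iff_isUnit_det _).1 (by simpa using hQ.isUnit.neg : IsUnit Q)
    rw [neg_mul_neg, mul_nonsing_inv _ this]
  set E : Matrix (Fin p ⊕ Fin n) (Fin p ⊕ Fin n) ℝ := fromBlocks (-Q)⁻¹ 0 0 P⁻¹ with hE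
  have hEpos : E.PosDef := posDef_fromBlocks_diagonal hQ.inv hP.inv
  have hEinv : E⁻¹ = fromBlocks (-Q) 0 0 P := by
    refine inv_eq_right_inv ?_
    rw [hE, fromBlocks_multiply,
      nonsing_inv_mul _ ((isUnit_iff_isUnit_det _).1 hQ.isUnit),
      nonsing_inv_mul _ ((isUnit_iff_isUnit_det _).1 hP.isUnit)]
    simp
  let _ : Invertible E := hEpos.isUnit.invertible
  set F : Matrix (Fin p ⊕ Fin n) (Fin n ⊕ Fin m) ℝ := fromBlocks G.C G.D G.A G.B with hF
  set K : Matrix (Fin n ⊕ Fin m) (Fin n ⊕ Fin m) ℝ :=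
    fromBlocks P (G.Cᵀ * S) (Sᵀ * G.C) (G.Dᵀ * S + Sᵀ * G.D + R) with hK
  have hlmi : -(G.lmiMatrix Q S R P) = fromBlocks K (-Fᴴ) (-Fᴴ)ᴴ E := by
    have hd : -(-(G.Dᵀ * S) - Sᵀ * G.D - R) = G.Dᵀ * S + Sᵀ * G.D + R := by abel
    rw [lmiMatrix, hK, hF, hE, hQi, conjTranspose_neg, conjTranspose_conjTranspose,
      fromBlocks_conjTranspose]
    simp only [fromBlocks_neg, conjTranspose_eq_transpose_of_trivial, neg_neg, neg_zero, hd]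
  have hKh : K.IsHermitian := by
    refine hP.isHermitian.fromBlocks ?_ ?_
    · simp
    · have hRt : Rᵀ = R := hR
      simp only [IsHermitian, conjTranspose_eq_transpose_of_trivial, transpose_add,
        transpose_mul, transpose_transpose, hRt]
      rw [add_comm (Sᵀ * G.D)]
  have hform : ∀ x u, Sum.elim x u ⬝ᵥ ((K - (-Fᴴ) * E⁻¹ * (-Fᴴ)ᴴ) *ᵥ Sum.elim x u) =
      x ⬝ᵥ (P *ᵥ x) + supply Q S R u (G.C *ᵥ x + G.D *ᵥ u) -
        (G.A *ᵥ x + G.B *ᵥ u) ⬝ᵥ (P *ᵥ (G.A *ᵥ x + G.B *ᵥ u)) := by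
    intro x u
    have h1 : Sum.elim x u ⬝ᵥ (K *ᵥ Sum.elim x u) = x ⬝ᵥ (P *ᵥ x) +
        2 * ((G.C *ᵥ x + G.D *ᵥ u) ⬝ᵥ (S *ᵥ u)) + u ⬝ᵥ (R *ᵥ u) := by
      have t1 : x ⬝ᵥ ((G.Cᵀ * S) *ᵥ u) = (G.C *ᵥ x) ⬝ᵥ (S *ᵥ u) := by
        rw [← mulVec_mulVec, dotProduct_mulVec, vecMul_transpose]
      have t2 : u ⬝ᵥ ((G.Dᵀ * S) *ᵥ u) = (G.D *ᵥ u) ⬝ᵥ (S *ᵥ u) := by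
        rw [← mulVec_mulVec, dotProduct_mulVec, vecMul_transpose]
      have t3 : u ⬝ᵥ ((Sᵀ * G.C) *ᵥ x) = (G.C *ᵥ x) ⬝ᵥ (S *ᵥ u) := by
        rw [← mulVec_mulVec, dotProduct_mulVec, vecMul_transpose, dotProduct_comm]
      have t4 : u ⬝ᵥ ((Sᵀ * G.D) *ᵥ u) = (G.D *ᵥ u) ⬝ᵥ (S *ᵥ u) := by
        rw [← mulVec_mulVec, dotProduct_mulVec, vecMul_transpose, dotProduct_comm]
      simp only [hK, fromBlocks_mulVec, Sum.elim_comp_inl, Sum.elim_comp_inr,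
        sumElim_dotProduct_sumElim, dotProduct_add, add_dotProduct, add_mulVec, t1, t2, t3, t4]
      ring
    have h2 : Sum.elim x u ⬝ᵥ (((-Fᴴ) * E⁻¹ * (-Fᴴ)ᴴ) *ᵥ Sum.elim x u) =
        (F *ᵥ Sum.elim x u) ⬝ᵥ (E⁻¹ *ᵥ (F *ᵥ Sum.elim x u)) := by
      rw [conjTranspose_neg, conjTranspose_conjTranspose, Matrix.mul_neg, Matrix.neg_mul,
        Matrix.neg_mul, neg_neg, Matrix.mul_assoc, ← mulVec_mulVec, ← mulVec_mulVec,
        conjTranspose_eq_transpose_of_trivial, dotProduct_mulVec, vecMul_transpose]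
    rw [sub_mulVec, dotProduct_sub, h1, h2, hEinv, hF]
    simp only [fromBlocks_mulVec, Sum.elim_comp_inl, Sum.elim_comp_inr, zero_mulVec, add_zero,
      zero_add, sumElim_dotProduct_sumElim, supply, neg_mulVec, dotProduct_neg]
    ring
  rw [hlmi, PosDef.fromBlocks₂₂ _ _ hEpos]
  constructor
  · intro h x u
    have := h.dotProduct_mulVec_nonneg (Sum.elim x u)
    rw [star_trivial, hform] at this
    linarith
  · intro h
    refine .of_dotProduct_mulVec_nonneg ?_ fun z => ?_
    · exact hKh.sub (isHermitian_mul_mul_conjTranspose _ hEpos.inv.isHermitian)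
    · rw [star_trivial, ← Sum.elim_comp_inl_inr z, hform]
      linarith [h (z ∘ Sum.inl) (z ∘ Sum.inr)]

/-- -Q⁻¹ is a principal submatrix, hence positive semidefinite; invertibility makes it definite. -/
theorem posDef_neg_of_posSemidef_neg_lmiMatrix (hQ : IsUnit Q) {P : Matrix (Fin n) (Fin n) ℝ}
    (h : (-(G.lmiMatrix Q S R P)).PosSemidef) : (-Q).PosDef := by
  have h1 : (-Q⁻¹).PosSemidef := h.submatrix fun i => Sum.inr (Sum.inl i)
  have hd := (isUnit_iff_isUnit_det _).1 hQ
  have h2 : (-Q⁻¹)⁻¹ = -Q := inv_eq_right_inv (by rw [neg_mul_neg, nonsing_inv_mul _ hd])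
  have h3 : (-Q⁻¹).PosDef := h1.posDef_iff_isUnit.2
    (((isUnit_iff_isUnit_det _).2 (isUnit_nonsing_inv_det _ hd)).neg)
  exact h2 ▸ h3.inv

end Dissipative

end LTISystem

theorem mainTheorem1 {n m p : ℕ} (G : LTISystem n m p)
    (hcontr : G.IsControllable) (hobs : G.IsObservable)
    (Q : Matrix (Fin p) (Fin p) ℝ) (S : Matrix (Fin p) (Fin m) ℝ)
    (R : Matrix (Fin m) (Fin m) ℝ) (hR : R.IsSymm) :
    ((-Q).PosDef ∧ G.IsDissipative Q S R) ↔
      (IsUnit Q ∧ ∃ P : Matrix (Fin n) (Fin n) ℝ, P.PosDef ∧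
        (-(G.lmiMatrix Q S R P)).PosSemidef) := by
  constructor
  · rintro ⟨hQ, h⟩
    obtain ⟨P, hP, hV⟩ := h.exists_posDef hQ hobs
    exact ⟨by simpa using hQ.isUnit.neg, P, hP,
      (LTISystem.posSemidef_neg_lmiMatrix_iff hR hQ hP).2 hV⟩
  · rintro ⟨hu, P, hP, h⟩
    have hQ := LTISystem.posDef_neg_of_posSemidef_neg_lmiMatrix hu h
    exact ⟨hQ, LTISystem.isDissipative_of_storage hP.posSemidef
      ((LTISystem.posSemidef_neg_lmiMatrix_iff hR hQ hP).1 h)⟩
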